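/- Let $n\ge 0$ be an integer and $\hbar>0$. Let $\hat A$ be a bounded operator on $L^2(\mathbb R^n)$ and let $a:\mathbb R^{2n}\to\mathbb C$ be an integrable function, $a\in L^1(\mathbb R^{2n})$, such that $\hat A=\mathrm{Op}_{\mathrm W}(a)$ is the Weyl operator with symbol $a$, i.e. for every $\psi\in L^2(\mathbb R^n)$ and almost every $x\in\mathbb R^n$ $$\hat A\psi(x)=\Big(\frac1{2\pi\hbar}\Big)^n\iint e^{\frac i\hbar p\cdot(x-y)}\,a\big(\tfrac12(x+y),p\big)\,\psi(y)\,d^ny\,d^np ,$$ the double integral being absolutely convergent. Suppose that $\hat A$ is of trace class, i.e. $\sum_j|\langle\hat A\phi_j|\chi_j\rangle|<\infty$ for all pairs $(\phi_j)$, $(\chi_j)$ of orthonormal bases of $L^2(\mathbb R^n)$ indexed by the same set. Then the trace $\operatorname{Tr}(\hat A)=\sum_j\langle\psi_j|\hat A\psi_j\rangle$ (a convergent series, whose sum does not depend on the choice of the orthonormal basis $(\psi_j)$ of $L^2(\mathbb R^n)$) is $$\operatorname{Tr}(\hat A)=\Big(\frac1{2\pi\hbar}\Big)^n\int_{\mathbb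 R^{2n}}a(z)\,d^{2n}z .$$ Equivalently, $\operatorname{Tr}(\hat A)=a_\sigma(0)$, where $$a_\sigma(z)=F_\sigma a(z)=\Big(\frac1{2\pi\hbar}\Big)^n\int_{\mathbb R^{2n}}e^{-\frac i\hbar\sigma(z,z')}a(z')\,d^{2n}z'$$ is the symplectic Fourier transform of $a$, with $\sigma(z,z')=p\cdot x'-p'\cdot x$ for $z=(x,p)$, $z'=(x',p')$. -/

import Mathlib

open MeasureTheory

noncomputable section

namespace WeylTrace

/-- Configuration space `ℝⁿ`. -/
abbrev Config (n : ℕ) : Type := EuclideanSpace ℝ (Fin n)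

/-- Phase space `ℝ²ⁿ = ℝⁿ × ℝⁿ`, with points `z = (x, p)` and Lebesgue measure. -/
abbrev Phase (n : ℕ) : Type := Config n × Config n

/-- The Hilbert space `L²(ℝⁿ)` of complex-valued square integrable functions. -/
abbrev L2 (n : ℕ) : Type := Lp ℂ 2 (volume : Measure (Config n))

section HilbertSpace

universe u

variable {H : Type u} [NormedAddCommGroup H] [InnerProductSpace ℂ H] [CompleteSpace H]

/-- A bounded operator `A` is of trace class if `∑ⱼ |⟨A φⱼ | χⱼ⟩| < ∞` for all pairs of orthonormal
bases `(φⱼ)`, `(χⱼ)` of the Hilbert space, indexed by the same set. -/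
def IsTraceClass (A : H →L[ℂ] H) : Prop :=
  ∀ (ι : Type u) (φ χ : HilbertBasis ι ℂ H), Summable fun j => ‖inner ℂ (A (φ j)) (χ j)‖

/-- The trace `∑ⱼ ⟨ψⱼ | A ψⱼ⟩` of `A`, computed in one fixed orthonormal basis `(ψⱼ)` of the Hilbert
space. (For operators of trace class the series converges and does not depend on the basis.) -/
def trace (A : H →L[ℂ] H) : ℂ :=
  ∑' j, inner ℂ ((exists_hilbertBasis ℂ H).choose_spec.choose j)
    (A ((exists_hilbertBasis ℂ H).choose_spec.choose j))

end HilbertSpace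

/-- The integrand `(y, p) ↦ e^{(i/ħ) p·(x - y)} a((x + y)/2, p) ψ(y)` of the Weyl correspondence. -/
def weylIntegrand {n : ℕ} (hbar : ℝ) (a : Phase n → ℂ) (ψ : Config n → ℂ) (x : Config n)
    (w : Phase n) : ℂ :=
  Complex.exp (Complex.I / hbar * (inner ℝ w.2 (x - w.1) : ℝ)) *
    a ((1 / 2 : ℝ) • (x + w.1), w.2) * ψ w.1

/-- `A = Op_W(a)`: for every `ψ ∈ L²(ℝⁿ)` and almost every `x`,
`A ψ (x) = (2πħ)⁻ⁿ ∬ e^{(i/ħ) p·(x - y)} a((x + y)/2, p) ψ(y) dy dp`,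
the double integral being absolutely convergent. (For an integrable symbol `a` the absolute
convergence for almost every `x` is automatic.) -/
def IsWeylOperator {n : ℕ} (hbar : ℝ) (a : Phase n → ℂ) (A : L2 n →L[ℂ] L2 n) : Prop :=
  ∀ ψ : L2 n, ∀ᵐ x : Config n, Integrable (weylIntegrand hbar a ψ x) ∧
    A ψ x = (1 / (2 * Real.pi * hbar) : ℂ) ^ n * ∫ w : Phase n, weylIntegrand hbar a ψ x w

/-- The standard symplectic form `σ(z, z') = (z')ᵀ J z = p·x' - p'·x`, for `z = (x, p)` and
`z' = (x', p')`. -/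
def symplecticForm {n : ℕ} (z z' : Phase n) : ℝ :=
  inner ℝ z.2 z'.1 - inner ℝ z'.2 z.1

/-- The symplectic Fourier transform
`F_σ a (z) = (2πħ)⁻ⁿ ∫ e^{-(i/ħ) σ(z, z')} a(z') dz'` of an integrable function `a`. -/
def symplecticFourier {n : ℕ} (hbar : ℝ) (a : Phase n → ℂ) (z : Phase n) : ℂ :=
  (1 / (2 * Real.pi * hbar) : ℂ) ^ n *
    ∫ z' : Phase n, Complex.exp (-(Complex.I / hbar) * (symplecticForm z z' : ℝ)) * a z'

end WeylTrace

end

/-! The kernel of a Weyl operator with an `L¹` symbol need not be continuous, so it cannot simply be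
integrated over the diagonal. The trace is averaged over Gaussian coherent states `φ_z` instead.
They form a tight frame, `∫ |⟨f, φ_z⟩|² dz = C ‖f‖²` (`lintegral_enorm_inner_coherent_sq`), and for
an operator with absolutely summable diagonals this forces `∫ ⟨φ_z, A φ_z⟩ dz = C Tr A`
(`hasFrameTrace_of_forall_summable`). On the symbol side, `⟨φ_z, A φ_z⟩` is `(2πħ)⁻ⁿ (a ∗ W)(z)`
with `W` a Gaussian on phase space (`inner_coherent_apply_coherent`). Its integral is `(2πħ)⁻ⁿ ∫ a ·
∫ W`, and `∫ W = C`. Cancelling `C > 0` gives the formula in every basis at once. -/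

open scoped ENNReal InnerProductSpace

/-! ### Traces computed by integration over a continuous tight frame. -/

section HilbertSpace

variable {H : Type*} [NormedAddCommGroup H] [InnerProductSpace ℂ H]

/-- Parseval's identity with values in `ℝ≥0∞`. -/
theorem HilbertBasis.tsum_enorm_inner_sq {ι : Type*} (ψ : HilbertBasis ι ℂ H) (x : H) :
    ∑' i, ‖⟪ψ i, x⟫_ℂ‖ₑ ^ 2 = ‖x‖ₑ ^ 2 := by
  have h := ψ.hasSum_inner_mul_inner x x
  have h' : HasSum (fun i => ‖⟪ψ i, x⟫_ℂ‖ ^ 2) (‖x‖ ^ 2) := by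
    have h2 := Complex.hasSum_re h
    convert h2 using 1
    · ext i
      rw [← inner_conj_symm x (ψ i), ← Complex.normSq_eq_conj_mul_self, Complex.ofReal_re,
        Complex.normSq_eq_norm_sq]
    · rw [inner_self_eq_norm_sq_to_K]
      norm_cast
  have h3 := ENNReal.ofReal_tsum_of_nonneg (fun i => by positivity) h'.summable
  rw [h'.tsum_eq] at h3
  simpa [ENNReal.ofReal_pow, ofReal_norm] using h3.symm

/-- Orthonormal vectors lie at distance `√2 > 1`, so the balls of radius `1/2` around them are
disjoint. Countability is what later lets a sum over the basis be exchanged with an integral. -/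
theorem HilbertBasis.countable_of_separableSpace [TopologicalSpace.SeparableSpace H] {ι : Type*}
    (ψ : HilbertBasis ι ℂ H) : Countable ι := by
  refine Pairwise.countable_of_isOpen_disjoint (s := fun i => Metric.ball (ψ i) (1 / 2)) ?_
    (fun i => Metric.isOpen_ball) (fun i => ⟨ψ i, Metric.mem_ball_self (by norm_num)⟩)
  intro i j hij
  refine Metric.ball_disjoint_ball ?_
  have h : ‖ψ i - ψ j‖ ^ 2 = 2 := by
    rw [@norm_sub_sq ℂ, ψ.orthonormal.2 hij, ψ.orthonormal.1, ψ.orthonormal.1]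
    norm_num
  rw [dist_eq_norm]
  nlinarith [norm_nonneg (ψ i - ψ j)]

section Frame

variable {Z : Type*} [MeasurableSpace Z] {μ : Measure Z} {φ : Z → H} {C : ℝ≥0∞} {ι : Type*}

/-- The trace of `A`, in the basis `ψ`, is given by integration over a continuous tight frame `φ`
with frame constant `C`. -/
def HasFrameTrace (μ : Measure Z) (φ : Z → H) (C : ℝ≥0∞) (ψ : HilbertBasis ι ℂ H)
    (A : H →L[ℂ] H) : Prop :=
  (Summable fun i => ⟪ψ i, A (ψ i)⟫_ℂ) ∧ (Integrable (fun z => ⟪φ z, A (φ z)⟫_ℂ) μ) ∧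
    ∫ z, ⟪φ z, A (φ z)⟫_ℂ ∂μ = C.toReal * ∑' i, ⟪ψ i, A (ψ i)⟫_ℂ

theorem HasFrameTrace.add {ψ : HilbertBasis ι ℂ H} {A B : H →L[ℂ] H}
    (hA : HasFrameTrace μ φ C ψ A) (hB : HasFrameTrace μ φ C ψ B) :
    HasFrameTrace μ φ C ψ (A + B) := by
  obtain ⟨a1, a2, a3⟩ := hA
  obtain ⟨b1, b2, b3⟩ := hB
  simp only [HasFrameTrace, add_apply, inner_add_right]
  refine ⟨a1.add b1, a2.add b2, ?_⟩
  rw [integral_add a2 b2, a1.tsum_add b1, a3, b3, mul_add]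

theorem HasFrameTrace.smul {ψ : HilbertBasis ι ℂ H} {A : H →L[ℂ] H} (c : ℂ)
    (hA : HasFrameTrace μ φ C ψ A) : HasFrameTrace μ φ C ψ (c • A) := by
  obtain ⟨a1, a2, a3⟩ := hA
  simp only [HasFrameTrace, smul_apply, inner_smul_right]
  refine ⟨a1.mul_left c, a2.const_mul c, ?_⟩
  rw [integral_const_mul, tsum_mul_left, a3]
  ring

variable [CompleteSpace H]

/-- The Hilbert–Schmidt norms of `S` and its adjoint agree, in any two bases. -/
theorem HilbertBasis.tsum_enorm_apply_sq {ι κ : Type*} (ψ : HilbertBasis ι ℂ H)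
    (e : HilbertBasis κ ℂ H) (S : H →L[ℂ] H) :
    ∑' i, ‖S (ψ i)‖ₑ ^ 2 = ∑' j, ‖ContinuousLinearMap.adjoint S (e j)‖ₑ ^ 2 := by
  simp_rw [← e.tsum_enorm_inner_sq (S _), ← ψ.tsum_enorm_inner_sq (ContinuousLinearMap.adjoint S _)]
  rw [ENNReal.tsum_comm]
  refine tsum_congr fun j => tsum_congr fun i => ?_
  rw [ContinuousLinearMap.adjoint_inner_right, ← inner_conj_symm, RCLike.enorm_conj]

/-- If `P` is self-adjoint and `N P = 0`, there is a Hilbert basis adapted to `ker N`, each of whose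
vectors is killed by `P` or by `N`. -/
theorem exists_hilbertBasis_forall_apply_eq_zero {P N : H →L[ℂ] H}
    (hP : IsSelfAdjoint P) (hNP : N * P = 0) :
    ∃ (w : Set H) (b : HilbertBasis w ℂ H), ∀ i, P (b i) = 0 ∨ N (b i) = 0 := by
  let K : Submodule ℂ H := N.ker
  have hK : IsClosed (K : Set H) := N.isClosed_ker
  have : CompleteSpace K := hK.completeSpace_coe
  obtain ⟨v, b, hb⟩ := exists_hilbertBasis ℂ K
  have hs : Orthonormal ℂ (fun i : v => (b i : H)) :=
    b.orthonormal.comp_linearIsometry K.subtypeₗᵢ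
  obtain ⟨w, c, hw, hc⟩ := hs.toSubtypeRange.exists_hilbertBasis_extension
  refine ⟨w, c, fun i => ?_⟩
  by_cases hi : (i : H) ∈ Set.range fun i : v => (b i : H)
  · obtain ⟨j, hj⟩ := hi
    right
    rw [hc, ← hj]
    exact (b j).2
  -- A basis vector outside the chosen basis of `ker N` is orthogonal to `ker N`, which contains the
  -- range of `P`. Self-adjointness then gives `⟪x, P c⟫ = ⟪P x, c⟫ = 0`.
  · left
    have h1 : ∀ j, ⟪(b j : H), c i⟫_ℂ = 0 := by
      intro j
      have hj : (b j : H) ∈ w := hw ⟨j, rfl⟩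
      have hji : (⟨b j, hj⟩ : w) ≠ i := by
        rintro rfl
        exact hi ⟨j, rfl⟩
      have := c.orthonormal.2 hji
      rwa [hc] at this ⊢
    have h2 : ∀ k : K, ⟪(k : H), c i⟫_ℂ = 0 := by
      intro k
      have h3 := b.hasSum_inner_mul_inner k (K.orthogonalProjectionOnto (c i))
      have h4 : ∀ k : K, ⟪k, K.orthogonalProjectionOnto (c i)⟫_ℂ = ⟪(k : H), c i⟫_ℂ := fun k => by
        rw [Submodule.inner_orthogonalProjectionOnto_eq_of_mem_left]
      simp only [h4, h1, mul_zero] at h3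
      exact h3.unique hasSum_zero
    refine ext_inner_left ℂ fun x => ?_
    have hPx : P x ∈ K := by
      have := DFunLike.congr_fun hNP x
      simpa [K] using this
    rw [inner_zero_right, ← ContinuousLinearMap.adjoint_inner_left]
    have : ContinuousLinearMap.adjoint P = P := hP
    rw [this]
    exact h2 ⟨_, hPx⟩

/-- With `B = S* S` every term is a square: Parseval and Tonelli turn `∫ ‖S φ_z‖²` into `∑ ∫ |⟨S*
ψ_i, φ_z⟩|² = C ∑ ‖S* ψ_i‖²`, and the Hilbert–Schmidt norms of `S` and `S*` agree. -/
theorem hasFrameTrace_of_nonneg (hφ : ∀ f, AEMeasurable (fun z => ⟪f, φ z⟫_ℂ) μ)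
    (hC : C ≠ ∞) (hframe : ∀ f, ∫⁻ z, ‖⟪f, φ z⟫_ℂ‖ₑ ^ 2 ∂μ = C * ‖f‖ₑ ^ 2)
    [Countable ι] (ψ : HilbertBasis ι ℂ H) {B : H →L[ℂ] H} (hB : 0 ≤ B) {κ : Type*}
    (e : HilbertBasis κ ℂ H) (he : Summable fun j => ‖⟪B (e j), e j⟫_ℂ‖) :
    HasFrameTrace μ φ C ψ B := by
  obtain ⟨S, rfl⟩ := CStarAlgebra.nonneg_iff_eq_star_mul_self.mp hB
  have key : ∀ x, ⟪x, (star S * S) x⟫_ℂ = ((‖S x‖ ^ 2 : ℝ) : ℂ) := fun x => by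
    rw [mul_apply_eq_comp, ContinuousLinearMap.star_eq_adjoint,
      ContinuousLinearMap.adjoint_inner_right, inner_self_eq_norm_sq_to_K]
    norm_cast
  have key' : ∀ x, ‖⟪(star S * S) x, x⟫_ℂ‖ = ‖S x‖ ^ 2 := fun x => by
    rw [norm_inner_symm, key, Complex.norm_real, Real.norm_of_nonneg (by positivity)]
  have enn : ∀ x, ENNReal.ofReal (‖S x‖ ^ 2) = ‖S x‖ₑ ^ 2 := fun x => by
    rw [ENNReal.ofReal_pow (norm_nonneg _), ofReal_norm]
  simp only [key'] at he
  have hfin : ∑' i, ‖S (ψ i)‖ₑ ^ 2 ≠ ∞ := by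
    -- Finiteness is carried from the basis `e` to `ψ` by way of `S*`.
    rw [ψ.tsum_enorm_apply_sq ψ, ← e.tsum_enorm_apply_sq ψ]
    simp_rw [← enn]
    exact he.tsum_ofReal_ne_top
  have hsum : Summable fun i => ‖S (ψ i)‖ ^ 2 := by
    simp_rw [← enn] at hfin
    have := ENNReal.summable_toReal hfin
    simpa [ENNReal.toReal_ofReal] using this
  have hexp : ∀ z, ‖S (φ z)‖ₑ ^ 2 = ∑' i, ‖⟪ContinuousLinearMap.adjoint S (ψ i), φ z⟫_ℂ‖ₑ ^ 2 :=
    fun z => by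
      simp_rw [← ψ.tsum_enorm_inner_sq (S (φ z)), ContinuousLinearMap.adjoint_inner_left]
  have hmeas : ∀ i, AEMeasurable
      (fun z => ‖⟪ContinuousLinearMap.adjoint S (ψ i), φ z⟫_ℂ‖ₑ ^ 2) μ :=
    fun i => ((hφ _).enorm).pow_const 2
  have hlint : ∫⁻ z, ‖S (φ z)‖ₑ ^ 2 ∂μ = C * ∑' i, ‖S (ψ i)‖ₑ ^ 2 := by
    simp_rw [hexp]
    rw [lintegral_tsum hmeas]
    simp_rw [hframe]
    rw [ENNReal.tsum_mul_left, ← ψ.tsum_enorm_apply_sq ψ]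
  -- Only weak measurability of `φ` is assumed, so measurability of the norm comes from the
  -- countable expansion.
  have hm : AEMeasurable (fun z => ‖S (φ z)‖ ^ 2) μ := by
    have : AEMeasurable (fun z => ‖S (φ z)‖ₑ ^ 2) μ := by
      simp_rw [hexp]
      exact AEMeasurable.tsum hmeas
    simpa using this.ennreal_toReal
  have hint : Integrable (fun z => ‖S (φ z)‖ ^ 2) μ := by
    refine ⟨hm.aestronglyMeasurable, ?_⟩
    rw [hasFiniteIntegral_iff_ofReal (Filter.Eventually.of_forall fun z => by positivity)]
    simp_rw [enn, hlint]
    exact ENNReal.mul_lt_top hC.lt_top hfin.lt_top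
  simp only [HasFrameTrace, key]
  refine ⟨Complex.ofRealCLM.summable hsum, hint.ofReal, ?_⟩
  rw [integral_complex_ofReal, ← Complex.ofReal_tsum, ← Complex.ofReal_mul,
    integral_eq_lintegral_of_nonneg_ae (Filter.Eventually.of_forall fun z => by positivity)
      hm.aestronglyMeasurable]
  simp_rw [enn]
  rw [hlint, ENNReal.toReal_mul]
  simp_rw [← enn]
  rw [← ENNReal.ofReal_tsum_of_nonneg (fun i => by positivity) hsum,
    ENNReal.toReal_ofReal (tsum_nonneg fun i => by positivity)]

/-- In a basis whose vectors are each killed by `B⁺` or by `B⁻`, the diagonals of both parts are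
dominated by that of `B`. This basis depends on `B`, hence a hypothesis on all bases. -/
theorem hasFrameTrace_of_isSelfAdjoint (hφ : ∀ f, AEMeasurable (fun z => ⟪f, φ z⟫_ℂ) μ)
    (hC : C ≠ ∞) (hframe : ∀ f, ∫⁻ z, ‖⟪f, φ z⟫_ℂ‖ₑ ^ 2 ∂μ = C * ‖f‖ₑ ^ 2)
    [Countable ι] (ψ : HilbertBasis ι ℂ H) {B : H →L[ℂ] H} (hB : IsSelfAdjoint B)
    (h : ∀ (w : Set H) (e : HilbertBasis w ℂ H), Summable fun j => ‖⟪B (e j), e j⟫_ℂ‖) :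
    HasFrameTrace μ φ C ψ B := by
  obtain ⟨w, e, he⟩ := exists_hilbertBasis_forall_apply_eq_zero (P := B⁺) (N := B⁻)
    (CFC.posPart_nonneg B).isSelfAdjoint (CFC.negPart_mul_posPart B)
  have hdec : ∀ x, B x = B⁺ x - B⁻ x := fun x => by
    conv_lhs => rw [← CFC.posPart_sub_negPart B hB]
    rfl
  have hpos : HasFrameTrace μ φ C ψ B⁺ := by
    refine hasFrameTrace_of_nonneg hφ hC hframe ψ (CFC.posPart_nonneg B) e
      ((h w e).of_nonneg_of_le (fun _ => norm_nonneg _) fun j => ?_)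
    rcases he j with h0 | h0 <;> simp [hdec, h0]
  have hneg : HasFrameTrace μ φ C ψ B⁻ := by
    refine hasFrameTrace_of_nonneg hφ hC hframe ψ (CFC.negPart_nonneg B) e
      ((h w e).of_nonneg_of_le (fun _ => norm_nonneg _) fun j => ?_)
    rcases he j with h0 | h0 <;> simp [hdec, h0]
  have := hpos.add (hneg.smul (-1))
  rwa [neg_one_smul, ← sub_eq_add_neg, CFC.posPart_sub_negPart B hB] at this

/-- For an operator whose diagonal is absolutely summable in every Hilbert basis, integration over
a continuous tight frame computes the trace in any given basis. -/
theorem hasFrameTrace_of_forall_summable (hφ : ∀ f, AEMeasurable (fun z => ⟪f, φ z⟫_ℂ) μ)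
    (hC : C ≠ ∞) (hframe : ∀ f, ∫⁻ z, ‖⟪f, φ z⟫_ℂ‖ₑ ^ 2 ∂μ = C * ‖f‖ₑ ^ 2)
    [Countable ι] (ψ : HilbertBasis ι ℂ H) (A : H →L[ℂ] H)
    (h : ∀ (w : Set H) (e : HilbertBasis w ℂ H), Summable fun j => ‖⟪A (e j), e j⟫_ℂ‖) :
    HasFrameTrace μ φ C ψ A := by
  -- The diagonals of the real and imaginary parts are the real and imaginary parts of the diagonal
  -- of `A`.
  have hre : ∀ x, ‖⟪(realPart A : H →L[ℂ] H) x, x⟫_ℂ‖ ≤ ‖⟪A x, x⟫_ℂ‖ := fun x => by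
    have : (realPart A : H →L[ℂ] H) x = (2⁻¹ : ℂ) • (A x + ContinuousLinearMap.adjoint A x) := by
      rw [realPart_apply_coe, ← ContinuousLinearMap.star_eq_adjoint]
      simp only [smul_apply, add_apply, ← Complex.coe_smul]
      simp
    rw [this, inner_smul_left, inner_add_left, ContinuousLinearMap.adjoint_inner_left, norm_mul]
    have h2 := norm_add_le ⟪A x, x⟫_ℂ ⟪x, A x⟫_ℂ
    rw [norm_inner_symm x] at h2
    simp only [map_inv₀, map_ofNat, norm_inv, RCLike.norm_ofNat]
    linarith
  have him : ∀ x, ‖⟪(imaginaryPart A : H →L[ℂ] H) x, x⟫_ℂ‖ ≤ ‖⟪A x, x⟫_ℂ‖ := fun x => by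
    have h1 : (imaginaryPart A : H →L[ℂ] H) x =
        (-Complex.I) • (2⁻¹ : ℂ) • (A x - ContinuousLinearMap.adjoint A x) := by
      rw [imaginaryPart_apply_coe, ← ContinuousLinearMap.star_eq_adjoint]
      simp only [smul_apply, sub_apply, ← Complex.coe_smul]
      simp
    rw [h1, inner_smul_left, inner_smul_left, inner_sub_left,
      ContinuousLinearMap.adjoint_inner_left, norm_mul, norm_mul]
    have h2 := norm_sub_le ⟪A x, x⟫_ℂ ⟪x, A x⟫_ℂ
    rw [norm_inner_symm x] at h2
    simp only [map_inv₀, map_ofNat, norm_inv, RCLike.norm_ofNat, map_neg, Complex.conj_I, neg_neg,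
      Complex.norm_I]
    linarith
  have h1 := hasFrameTrace_of_isSelfAdjoint hφ hC hframe ψ (realPart A).2
    fun w e => (h w e).of_nonneg_of_le (fun _ => norm_nonneg _) fun j => hre (e j)
  have h2 := hasFrameTrace_of_isSelfAdjoint hφ hC hframe ψ (imaginaryPart A).2
    fun w e => (h w e).of_nonneg_of_le (fun _ => norm_nonneg _) fun j => him (e j)
  have := h1.add (h2.smul Complex.I)
  rwa [realPart_add_I_smul_imaginaryPart] at this

end Frame

end HilbertSpace

theorem MeasureTheory.L2.lintegral_enorm_sq {α E : Type*} [MeasurableSpace α] {μ : Measure α}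
    [NormedAddCommGroup E] (g : Lp E 2 μ) : ∫⁻ x, ‖g x‖ₑ ^ 2 ∂μ = ‖g‖ₑ ^ 2 := by
  rw [Lp.enorm_def, eLpNorm_eq_lintegral_rpow_enorm_toReal (by norm_num) (by norm_num),
    ← ENNReal.rpow_natCast, ← ENNReal.rpow_mul]
  simp

/-! ### Plancherel's identity on `L¹ ∩ L²`. -/

section Plancherel

open FourierTransform

variable {V : Type*} [NormedAddCommGroup V] [InnerProductSpace ℝ V] [FiniteDimensional ℝ V]
  [MeasurableSpace V] [BorelSpace V]

theorem continuous_fourier_of_integrable {f : V → ℂ} (hf : Integrable f) : Continuous (𝓕 f) :=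
  VectorFourier.fourierIntegral_continuous Real.continuous_fourierChar
    (by simpa using continuous_inner) hf

/-- On `L¹ ∩ L²`, the Fourier transform of `L²` is given by the Fourier integral. -/
theorem fourier_toLp_ae_eq {f : V → ℂ} (hf : Integrable f) (hf2 : MemLp f 2) :
    (𝓕 (hf2.toLp f) : Lp ℂ 2 (volume : Measure V)) =ᵐ[volume] 𝓕 f := by
  -- Both sides are tested against smooth compactly supported `g`, where `∫ ĝ f = ∫ g f̂` identifies
  -- them.
  refine ae_eq_of_integral_contDiff_smul_eq
    ((Lp.memLp _).locallyIntegrable (by norm_num))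
    (continuous_fourier_of_integrable hf).locallyIntegrable fun g hg hgc => ?_
  have hgc' : HasCompactSupport fun x => (g x : ℂ) := hgc.comp_left Complex.ofReal_zero
  let η := hgc'.toSchwartzMap (Complex.ofRealCLM.contDiff.comp hg)
  have hη : ∀ x, η x = (g x : ℂ) := fun x => rfl
  have h1 := DFunLike.congr_fun (Lp.fourier_toTemperedDistribution_eq (hf2.toLp f)) η
  rw [TemperedDistribution.fourier_apply, Lp.toTemperedDistribution_apply,
    Lp.toTemperedDistribution_apply] at h1
  have h2 : ∫ ξ, 𝓕 (η : V → ℂ) ξ • f ξ = ∫ x, η x • 𝓕 f x := by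
    simpa using! (VectorFourier.integral_fourierIntegral_smul_eq_flip (L := innerₗ V)
      Real.continuous_fourierChar continuous_inner η.integrable hf)
  simp only [hη, Complex.coe_smul] at h1 h2
  rw [← h1, ← h2]
  refine integral_congr_ae ?_
  filter_upwards [hf2.coeFn_toLp] with x hx
  rw [hx, SchwartzMap.fourier_coe]

/-- Plancherel's identity for the Fourier integral on `L¹ ∩ L²`. -/
theorem lintegral_enorm_fourier_sq {f : V → ℂ} (hf : Integrable f) (hf2 : MemLp f 2) :
    ∫⁻ ξ, ‖𝓕 f ξ‖ₑ ^ 2 = ∫⁻ x, ‖f x‖ₑ ^ 2 := by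
  have h1 : ∫⁻ ξ, ‖𝓕 f ξ‖ₑ ^ 2 = ∫⁻ ξ, ‖(𝓕 (hf2.toLp f) : Lp ℂ 2 (volume : Measure V)) ξ‖ₑ ^ 2 :=
    lintegral_congr_ae (by
      filter_upwards [fourier_toLp_ae_eq hf hf2] with x hx
      rw [hx])
  have h2 : ∫⁻ x, ‖f x‖ₑ ^ 2 = ∫⁻ ξ, ‖hf2.toLp f ξ‖ₑ ^ 2 :=
    lintegral_congr_ae (by
      filter_upwards [hf2.coeFn_toLp] with x hx
      rw [hx])
  rw [h1, h2, L2.lintegral_enorm_sq, L2.lintegral_enorm_sq, ← ofReal_norm, Lp.norm_fourier_eq,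
    ofReal_norm]

end Plancherel

section Gaussian

variable {V : Type*} [NormedAddCommGroup V] [InnerProductSpace ℝ V] [FiniteDimensional ℝ V]
  [MeasurableSpace V] [BorelSpace V]

theorem integrable_rexp_neg_mul_sq_norm {b : ℝ} (hb : 0 < b) :
    Integrable fun x : V => Real.exp (-b * ‖x‖ ^ 2) := by
  have := (GaussianFourier.integrable_cexp_neg_mul_sq_norm_add (b := (b : ℂ)) (V := V)
    (by simpa using hb) 0 0).norm
  refine this.congr (Filter.Eventually.of_forall fun x => ?_)
  simp only [Complex.norm_exp]
  congr 1
  simp [← Complex.ofReal_pow]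

end Gaussian

/-! ### Coherent states and their frame identity. -/

namespace WeylTrace

open FourierTransform

variable {n : ℕ} {hbar : ℝ}

instance : SecondCountableTopology (L2 n) := by
  have : Fact ((2 : ℝ≥0∞) ≠ ∞) := ⟨by simp⟩
  infer_instance

/-- The (unnormalised) coherent state centred at the phase space point `z = (q, p)`. -/
noncomputable def coherentFun (hbar : ℝ) (z : Phase n) (x : Config n) : ℂ :=
  Complex.exp (Complex.I / hbar * (⟪z.2, x⟫_ℝ : ℝ)) *
    (Real.exp (-(1 / (2 * hbar)) * ‖x - z.1‖ ^ 2) : ℝ)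

theorem norm_coherentFun (z : Phase n) (x : Config n) :
    ‖coherentFun hbar z x‖ = Real.exp (-(1 / (2 * hbar)) * ‖x - z.1‖ ^ 2) := by
  rw [coherentFun, norm_mul, Complex.norm_real, Real.norm_of_nonneg (Real.exp_pos _).le,
    Complex.norm_exp]
  have : (Complex.I / hbar * ((⟪z.2, x⟫_ℝ : ℝ) : ℂ)).re = 0 := by
    rw [show Complex.I / hbar * ((⟪z.2, x⟫_ℝ : ℝ) : ℂ) =
      ((⟪z.2, x⟫_ℝ / hbar : ℝ) : ℂ) * Complex.I by push_cast; ring]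
    simp
  rw [this, Real.exp_zero, one_mul]

theorem continuous_coherentFun_uncurry :
    Continuous fun w : Phase n × Config n => coherentFun hbar w.1 w.2 := by
  unfold coherentFun
  fun_prop

theorem continuous_coherentFun (z : Phase n) : Continuous (coherentFun hbar z) := by
  unfold coherentFun
  fun_prop

theorem norm_coherentFun_sq (z : Phase n) (x : Config n) :
    ‖coherentFun hbar z x‖ ^ 2 = Real.exp (-(1 / hbar) * ‖x - z.1‖ ^ 2) := by
  rw [norm_coherentFun, ← Real.exp_nat_mul]
  congr 1
  push_cast
  ring

theorem memLp_coherentFun (hhbar : 0 < hbar) (z : Phase n) : MemLp (coherentFun hbar z) 2 := by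
  rw [memLp_two_iff_integrable_sq_norm (continuous_coherentFun z).aestronglyMeasurable]
  simp_rw [norm_coherentFun_sq]
  exact (integrable_rexp_neg_mul_sq_norm (by positivity : 0 < 1 / hbar)).comp_sub_right z.1

/-- The coherent state at `z`, as an element of `L²`. -/
noncomputable def coherent (hhbar : 0 < hbar) (z : Phase n) : L2 n :=
  (memLp_coherentFun hhbar z).toLp _

theorem inner_coherent (hhbar : 0 < hbar) (f : L2 n) (z : Phase n) :
    ⟪f, coherent hhbar z⟫_ℂ = ∫ x, coherentFun hbar z x * starRingEnd ℂ (f x) := by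
  rw [L2.inner_def]
  refine integral_congr_ae ?_
  filter_upwards [(memLp_coherentFun hhbar z).coeFn_toLp] with x hx
  rw [coherent, hx, RCLike.inner_apply]

theorem stronglyMeasurable_inner_coherent (hhbar : 0 < hbar) (f : L2 n) :
    StronglyMeasurable fun z : Phase n => ⟪f, coherent hhbar z⟫_ℂ := by
  simp_rw [inner_coherent]
  refine StronglyMeasurable.integral_prod_right (f := fun (z : Phase n) (x : Config n) =>
    coherentFun hbar z x * starRingEnd ℂ (f x)) ?_
  exact continuous_coherentFun_uncurry.stronglyMeasurable.mul
    (Complex.continuous_conj.comp_stronglyMeasurable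
      ((Lp.stronglyMeasurable f).comp_measurable measurable_snd))

/-- The frame constant of the coherent states. -/
noncomputable def coherentConst (n : ℕ) (hbar : ℝ) : ℝ :=
  (2 * Real.pi * hbar) ^ n * (Real.pi * hbar) ^ (n / 2 : ℝ)

theorem lintegral_comp_smul {c : ℝ} (hc : c ≠ 0) {F : Config n → ℝ≥0∞} (hF : Measurable F) :
    ∫⁻ p, F (c • p) = ENNReal.ofReal |(c ^ n)⁻¹| * ∫⁻ p, F p := by
  rw [← lintegral_map hF (measurable_const_smul c), Measure.map_addHaar_smul _ hc,
    lintegral_smul_measure, finrank_euclideanSpace_fin, smul_eq_mul]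

theorem lintegral_enorm_coherentFun_sq (hhbar : 0 < hbar) (x : Config n) (p : Config n) :
    ∫⁻ q, ‖coherentFun hbar (q, p) x‖ₑ ^ 2 = ENNReal.ofReal ((Real.pi * hbar) ^ (n / 2 : ℝ)) := by
  have hb : 0 < 1 / hbar := by positivity
  have h : ∀ q, ‖coherentFun hbar (q, p) x‖ₑ ^ 2 =
      ENNReal.ofReal (Real.exp (-(1 / hbar) * ‖x - q‖ ^ 2)) := fun q => by
    rw [← norm_coherentFun_sq (q, p) x, ENNReal.ofReal_pow (norm_nonneg _), ofReal_norm]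
  simp_rw [h]
  rw [← ofReal_integral_eq_lintegral_ofReal
    ((integrable_rexp_neg_mul_sq_norm hb).comp_sub_left x)
    (Filter.Eventually.of_forall fun _ => (Real.exp_pos _).le),
    integral_sub_left_eq_self (fun q => Real.exp (-(1 / hbar) * ‖q‖ ^ 2)) volume x,
    GaussianFourier.integral_rexp_neg_mul_sq_norm hb, finrank_euclideanSpace_fin]
  simp

/-- Moyal's identity: the coherent states form a continuous tight frame. -/
theorem lintegral_enorm_inner_coherent_sq (hhbar : 0 < hbar) (f : L2 n) :
    ∫⁻ z : Phase n, ‖⟪f, coherent hhbar z⟫_ℂ‖ₑ ^ 2 =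
      ENNReal.ofReal (coherentConst n hbar) * ‖f‖ₑ ^ 2 := by
  have hc : -(2 * Real.pi * hbar)⁻¹ ≠ 0 :=
    neg_ne_zero.mpr (by have := Real.pi_pos; positivity)
  rw [Measure.volume_eq_prod, lintegral_prod _
    ((stronglyMeasurable_inner_coherent hhbar f).measurable.enorm.pow_const 2).aemeasurable]
  have hf2 : MemLp (fun x => starRingEnd ℂ (f x)) 2 := (Lp.memLp f).star
  -- For fixed `q`, the inner product is a Fourier transform in `p`, at frequency `-p/(2πħ)`.
  -- Plancherel applies, and the rescaling contributes `(2πħ)ⁿ`.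
  have hinner : ∀ q : Config n, ∫⁻ p, ‖⟪f, coherent hhbar (q, p)⟫_ℂ‖ₑ ^ 2 =
      ENNReal.ofReal ((2 * Real.pi * hbar) ^ n) *
        ∫⁻ x, ‖coherentFun hbar (q, 0) x‖ₑ ^ 2 * ‖f x‖ₑ ^ 2 := by
    intro q
    let g : Config n → ℂ := fun x => coherentFun hbar (q, 0) x * starRingEnd ℂ (f x)
    have hg : Integrable g := (memLp_coherentFun hhbar (q, 0)).integrable_mul hf2
    have hg2 : MemLp g 2 := by
      refine hf2.of_le_mul (c := 1)
        ((continuous_coherentFun _).aestronglyMeasurable.mul hf2.1)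
        (Filter.Eventually.of_forall fun x => ?_)
      rw [norm_mul]
      gcongr
      rw [norm_coherentFun, Real.exp_le_one_iff, neg_mul, neg_nonpos]
      positivity
    have hF : ∀ p, ⟪f, coherent hhbar (q, p)⟫_ℂ = 𝓕 g (-(2 * Real.pi * hbar)⁻¹ • p) := fun p => by
      rw [inner_coherent, Real.fourier_eq']
      congr 1
      ext x
      have : coherentFun hbar (q, p) x = Complex.exp
          ((-2 * Real.pi * ⟪x, -(2 * Real.pi * hbar)⁻¹ • p⟫_ℝ : ℝ) * Complex.I) *
          coherentFun hbar (q, 0) x := by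
        simp only [coherentFun, inner_zero_left, Complex.ofReal_zero, mul_zero, Complex.exp_zero,
          one_mul]
        congr 2
        rw [inner_smul_right, real_inner_comm]
        push_cast
        have h1 : (Real.pi : ℂ) ≠ 0 := by exact_mod_cast Real.pi_ne_zero
        have h2 : (hbar : ℂ) ≠ 0 := by exact_mod_cast hhbar.ne'
        field_simp
      rw [this, smul_eq_mul, mul_assoc]
    simp_rw [hF]
    rw [lintegral_comp_smul hc (F := fun p => ‖𝓕 g p‖ₑ ^ 2)
      ((continuous_fourier_of_integrable hg).measurable.enorm.pow_const 2),
      lintegral_enorm_fourier_sq hg hg2]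
    congr 1
    · congr 1
      rw [abs_inv, abs_pow, abs_neg, abs_of_pos (by have := Real.pi_pos; positivity), inv_pow,
        inv_inv]
    · refine lintegral_congr fun x => ?_
      rw [enorm_mul, mul_pow, RCLike.enorm_conj]
  simp_rw [hinner]
  have hm : Measurable fun w : Config n × Config n =>
      ‖coherentFun hbar (w.1, 0) w.2‖ₑ ^ 2 * ‖f w.2‖ₑ ^ 2 := by
    have h1 : Measurable fun w : Config n × Config n => coherentFun hbar (w.1, 0) w.2 :=
      (continuous_coherentFun_uncurry.comp (by fun_prop :
        Continuous fun w : Config n × Config n => (((w.1, 0) : Phase n), w.2))).measurable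
    have h2 : Measurable fun w : Config n × Config n => f w.2 :=
      (Lp.stronglyMeasurable f).measurable.comp measurable_snd
    exact (h1.enorm.pow_const 2).mul (h2.enorm.pow_const 2)
  rw [lintegral_const_mul _ hm.lintegral_prod_right', lintegral_lintegral_swap hm.aemeasurable]
  -- The remaining integral over `q` is a Gaussian mass independent of `x`.
  have hin : ∀ x : Config n, ∫⁻ q, ‖coherentFun hbar (q, 0) x‖ₑ ^ 2 * ‖f x‖ₑ ^ 2 =
      ENNReal.ofReal ((Real.pi * hbar) ^ (n / 2 : ℝ)) * ‖f x‖ₑ ^ 2 := fun x => by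
    rw [lintegral_mul_const' _ _ (by simp), lintegral_enorm_coherentFun_sq hhbar]
  simp_rw [hin]
  rw [lintegral_const_mul' _ _ (by simp), MeasureTheory.L2.lintegral_enorm_sq, ← mul_assoc,
    ← ENNReal.ofReal_mul (by have := Real.pi_pos; positivity), coherentConst]

/-! ### Diagonal matrix elements of a Weyl operator in coherent states. -/

/-- The change of variables `((m, p), u) ↦ (m + u/2, (m - u/2, p))`. -/
noncomputable def midpointHomeomorph (n : ℕ) : Phase n × Config n ≃ₜ Config n × Phase n where
  toFun v := (v.1.1 + (1 / 2 : ℝ) • v.2, (v.1.1 - (1 / 2 : ℝ) • v.2, v.1.2))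
  invFun v := (((1 / 2 : ℝ) • (v.1 + v.2.1), v.2.2), v.1 - v.2.1)
  left_inv v := by
    refine Prod.ext (Prod.ext ?_ rfl) ?_
    · simp only
      module
    · simp only
      module
  right_inv v := by
    refine Prod.ext ?_ (Prod.ext ?_ rfl)
    · simp only
      module
    · simp only
      module
  continuous_toFun := by fun_prop
  continuous_invFun := by fun_prop

theorem midpointHomeomorph_apply (v : Phase n × Config n) : midpointHomeomorph n v =
    (v.1.1 + (1 / 2 : ℝ) • v.2, (v.1.1 - (1 / 2 : ℝ) • v.2, v.1.2)) := rfl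

theorem measurePreserving_midpointHomeomorph (n : ℕ) :
    MeasurePreserving (midpointHomeomorph n) := by
  have h1 : MeasurePreserving (fun v : Config n × Phase n =>
      (v.1, (v.2.1 - (1 / 2 : ℝ) • v.1, v.2.2))) := by
    refine (MeasurePreserving.id volume).skew_product
      (g := fun (u : Config n) (w : Phase n) => (w.1 - (1 / 2 : ℝ) • u, w.2)) (by fun_prop)
      (Filter.Eventually.of_forall fun u => ?_)
    exact ((measurePreserving_sub_right volume ((1 / 2 : ℝ) • u)).prod
      (MeasurePreserving.id volume)).map_eq
  have h2 : MeasurePreserving (fun v : Phase n × Config n => (v.1, v.1.1 + v.2)) := by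
    refine (MeasurePreserving.id volume).skew_product
      (g := fun (w : Phase n) (u : Config n) => w.1 + u) (by fun_prop)
      (Filter.Eventually.of_forall fun w => ?_)
    exact (measurePreserving_add_left volume w.1).map_eq
  -- The map is a composition of two shears and coordinate swaps: first `m ↦ y = m - u/2`, then `u ↦
  -- x = y + u`.
  have h3 := Measure.measurePreserving_swap.comp (h2.comp (Measure.measurePreserving_swap.comp
    (h1.comp (Measure.measurePreserving_swap (μ := (volume : Measure (Phase n)))
      (ν := (volume : Measure (Config n)))))))
  convert h3 using 1
  · ext v : 1
    refine Prod.ext ?_ rfl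
    simp only [midpointHomeomorph_apply, Function.comp_apply, Prod.swap_prod_mk, Prod.fst_swap,
      Prod.snd_swap]
    module
  · rfl
  · rfl

/-- The Wigner function of the coherent state centred at the origin, up to normalisation. -/
noncomputable def coherentWigner (hbar : ℝ) (v : Phase n) : ℝ :=
  (4 * Real.pi * hbar) ^ (n / 2 : ℝ) *
    (Real.exp (-(1 / hbar) * ‖v.1‖ ^ 2) * Real.exp (-(1 / hbar) * ‖v.2‖ ^ 2))

theorem integrable_coherentWigner (hhbar : 0 < hbar) :
    Integrable (coherentWigner hbar : Phase n → ℝ) := by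
  have h : Integrable fun x : Config n => Real.exp (-(1 / hbar) * ‖x‖ ^ 2) :=
    integrable_rexp_neg_mul_sq_norm (by positivity)
  exact (h.mul_prod h).const_mul _

theorem integral_coherentWigner (hhbar : 0 < hbar) :
    ∫ v : Phase n, coherentWigner hbar v = coherentConst n hbar := by
  have hpi := Real.pi_pos
  simp_rw [coherentWigner]
  rw [integral_const_mul, Measure.volume_eq_prod,
    integral_prod_mul (fun x : Config n => Real.exp (-(1 / hbar) * ‖x‖ ^ 2))
      (fun x : Config n => Real.exp (-(1 / hbar) * ‖x‖ ^ 2)),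
    GaussianFourier.integral_rexp_neg_mul_sq_norm (by positivity), finrank_euclideanSpace_fin,
    coherentConst, show Real.pi / (1 / hbar) = Real.pi * hbar by field_simp, ← mul_assoc]
  congr 1
  -- The prefactor `(4πħ)^(n/2)` and one Gaussian mass `(πħ)^(n/2)` combine to `(2πħ)ⁿ`.
  rw [← Real.mul_rpow (by positivity) (by positivity),
    show 4 * Real.pi * hbar * (Real.pi * hbar) = (2 * Real.pi * hbar) ^ 2 by ring,
    ← Real.rpow_natCast, ← Real.rpow_mul (by positivity), ← Real.rpow_natCast]
  congr 1
  push_cast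
  ring

/-- The integrand of `⟨φ_z, Op_W(a) φ_z⟩` for a coherent state `φ_z`. -/
noncomputable def coherentIntegrand (hbar : ℝ) (a : Phase n → ℂ) (z : Phase n)
    (v : Config n × Phase n) : ℂ :=
  weylIntegrand hbar a (coherentFun hbar z) v.1 v.2 * starRingEnd ℂ (coherentFun hbar z v.1)

theorem coherentIntegrand_midpoint (a : Phase n → ℂ) (z : Phase n) (v : Phase n × Config n) :
    coherentIntegrand hbar a z (midpointHomeomorph n v) =
      a v.1 * (Real.exp (-(1 / hbar) * ‖v.1.1 - z.1‖ ^ 2) : ℝ) *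
        Complex.exp (-(1 / (4 * hbar) : ℝ) * ‖v.2‖ ^ 2 +
          Complex.I / hbar * (⟪v.1.2 - z.2, v.2⟫_ℝ : ℝ)) := by
  obtain ⟨⟨m, p⟩, u⟩ := v
  obtain ⟨q, k⟩ := z
  have e1 : (1 / 2 : ℝ) • (m + (1 / 2 : ℝ) • u + (m - (1 / 2 : ℝ) • u)) = m := by module
  have e2 : m + (1 / 2 : ℝ) • u - (m - (1 / 2 : ℝ) • u) = u := by module
  -- The parallelogram law separates the product of the two Gaussians into one in `m - q` and one in
  -- `u`.
  have e3 : ‖m + (1 / 2 : ℝ) • u - q‖ ^ 2 + ‖m - (1 / 2 : ℝ) • u - q‖ ^ 2 =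
      2 * ‖m - q‖ ^ 2 + 1 / 2 * ‖u‖ ^ 2 := by
    rw [show m + (1 / 2 : ℝ) • u - q = (m - q) + (1 / 2 : ℝ) • u by abel,
      show m - (1 / 2 : ℝ) • u - q = (m - q) - (1 / 2 : ℝ) • u by abel,
      norm_add_sq_real, norm_sub_sq_real (m - q), norm_smul, Real.norm_of_nonneg (by norm_num)]
    ring
  simp only [coherentIntegrand, midpointHomeomorph_apply, weylIntegrand, coherentFun, e1, e2,
    map_mul, Complex.conj_ofReal, ← Complex.exp_conj,
    map_div₀, Complex.conj_I, Complex.ofReal_exp]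
  have hexp : ∀ A B C D E F G : ℂ, A + B + C + D + E = F + G →
      Complex.exp A * a (m, p) * (Complex.exp B * Complex.exp C) *
        (Complex.exp D * Complex.exp E) = a (m, p) * Complex.exp F * Complex.exp G := by
    intro A B C D E F G h
    have := congrArg Complex.exp h
    simp only [Complex.exp_add] at this
    linear_combination a (m, p) * this
  apply hexp
  have e3' := congrArg (fun r : ℝ => (r : ℂ)) e3
  simp only [inner_add_right, inner_sub_right, inner_smul_right, inner_sub_left]
  push_cast at e3' ⊢
  linear_combination (-(1 / (2 * hbar)) : ℂ) * e3'

/-- The bound `|a(m, p)| exp(-‖u‖²/(4ħ))` is integrable because `a` is; this justifies Fubini in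
both coordinate systems. -/
theorem integrable_coherentIntegrand_midpoint (hhbar : 0 < hbar) {a : Phase n → ℂ}
    (ha : Integrable a) (z : Phase n) :
    Integrable fun v => coherentIntegrand hbar a z (midpointHomeomorph n v) := by
  have hb : 0 < 1 / (4 * hbar) := by positivity
  refine Integrable.mono' (ha.norm.mul_prod (integrable_rexp_neg_mul_sq_norm (V := Config n) hb))
    ?_ (Filter.Eventually.of_forall fun v => ?_)
  · simp_rw [coherentIntegrand_midpoint]
    refine (ha.1.comp_fst.mul ?_).mul ?_
    · exact Continuous.aestronglyMeasurable (by fun_prop)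
    · exact Continuous.aestronglyMeasurable (by fun_prop)
  · rw [coherentIntegrand_midpoint, norm_mul, norm_mul, Complex.norm_real,
      Real.norm_of_nonneg (Real.exp_pos _).le, Complex.norm_exp]
    have h1 : (-((1 / (4 * hbar) : ℝ) : ℂ) * ‖v.2‖ ^ 2 +
        Complex.I / hbar * (⟪v.1.2 - z.2, v.2⟫_ℝ : ℝ)).re = -(1 / (4 * hbar)) * ‖v.2‖ ^ 2 := by
      rw [show (-((1 / (4 * hbar) : ℝ) : ℂ) * ‖v.2‖ ^ 2 +
        Complex.I / hbar * (⟪v.1.2 - z.2, v.2⟫_ℝ : ℝ)) =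
          ((-(1 / (4 * hbar)) * ‖v.2‖ ^ 2 : ℝ) : ℂ) +
            ((⟪v.1.2 - z.2, v.2⟫_ℝ / hbar : ℝ) : ℂ) * Complex.I by push_cast; ring,
        Complex.add_re, Complex.ofReal_re, Complex.re_ofReal_mul,
        Complex.I_re, mul_zero, add_zero]
    rw [h1]
    gcongr
    refine mul_le_of_le_one_right (norm_nonneg _) ?_
    rw [Real.exp_le_one_iff, neg_mul, neg_nonpos]
    positivity

/-- The integral over `u` is the Fourier transform of a Gaussian, which supplies the decay in the
momentum variable. -/
theorem integral_coherentIntegrand_fiber (hhbar : 0 < hbar) (a : Phase n → ℂ) (z w : Phase n) :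
    ∫ u, coherentIntegrand hbar a z (midpointHomeomorph n (w, u)) =
      a w * (coherentWigner hbar (z - w) : ℝ) := by
  have hb : 0 < 1 / (4 * hbar) := by positivity
  have hpi := Real.pi_pos
  simp_rw [coherentIntegrand_midpoint]
  rw [integral_const_mul, GaussianFourier.integral_cexp_neg_mul_sq_norm_add (by simpa using hb),
    finrank_euclideanSpace_fin, mul_assoc, coherentWigner]
  congr 1
  have h1 : ((Real.pi : ℂ) / ((1 / (4 * hbar) : ℝ) : ℂ)) ^ (n / 2 : ℂ) =
      (((4 * Real.pi * hbar) ^ (n / 2 : ℝ) : ℝ) : ℂ) := by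
    rw [Complex.ofReal_cpow (by positivity), ← Complex.ofReal_div,
      show Real.pi / (1 / (4 * hbar)) = 4 * Real.pi * hbar by field_simp]
    push_cast
    rfl
  have h2 : (Complex.I / hbar) ^ 2 * (‖w.2 - z.2‖ : ℂ) ^ 2 / (4 * ((1 / (4 * hbar) : ℝ) : ℂ)) =
      ((-(1 / hbar) * ‖w.2 - z.2‖ ^ 2 : ℝ) : ℂ) := by
    have : (hbar : ℂ) ≠ 0 := by exact_mod_cast hhbar.ne'
    push_cast
    rw [div_pow, Complex.I_sq]
    field_simp
  rw [h1, h2, ← Complex.ofReal_exp, Prod.fst_sub, Prod.snd_sub, norm_sub_rev z.1, norm_sub_rev z.2]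
  push_cast
  ring

theorem inner_coherent_apply_coherent (hhbar : 0 < hbar) {a : Phase n → ℂ} (ha : Integrable a)
    {A : L2 n →L[ℂ] L2 n} (hA : IsWeylOperator hbar a A) (z : Phase n) :
    ⟪coherent hhbar z, A (coherent hhbar z)⟫_ℂ =
      (1 / (2 * Real.pi * hbar) : ℂ) ^ n * ∫ w, a w * (coherentWigner hbar (z - w) : ℝ) := by
  have hco : coherent hhbar z =ᵐ[volume] coherentFun hbar z :=
    (memLp_coherentFun hhbar z).coeFn_toLp
  have hmid := integrable_coherentIntegrand_midpoint hhbar ha z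
  have hemb := (midpointHomeomorph n).measurableEmbedding
  have hint : Integrable (coherentIntegrand hbar a z) :=
    ((measurePreserving_midpointHomeomorph n).integrable_comp_emb hemb).mp hmid
  calc ⟪coherent hhbar z, A (coherent hhbar z)⟫_ℂ
      = ∫ x, (1 / (2 * Real.pi * hbar) : ℂ) ^ n * ∫ w, coherentIntegrand hbar a z (x, w) := by
        rw [L2.inner_def]
        refine integral_congr_ae ?_
        filter_upwards [hA (coherent hhbar z), hco] with x hx hx'
        rw [RCLike.inner_apply, hx.2, hx', mul_assoc, ← integral_mul_const]
        congr 1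
        refine integral_congr_ae ?_
        -- The `L²` representative agrees with the Gaussian for almost every `y`, hence for almost
        -- every `(y, p)`.
        filter_upwards [Measure.quasiMeasurePreserving_fst.ae hco] with w hw
        simp only [coherentIntegrand, weylIntegrand, hw]
    _ = (1 / (2 * Real.pi * hbar) : ℂ) ^ n * ∫ v, coherentIntegrand hbar a z v := by
        rw [integral_const_mul]
        congr 1
        exact (integral_prod _ hint).symm
    _ = _ := by
        rw [← (measurePreserving_midpointHomeomorph n).integral_comp hemb]
        congr 1
        refine (integral_prod _ hmid).trans ?_
        simp_rw [integral_coherentIntegrand_fiber hhbar]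

theorem integral_inner_coherent_apply_coherent (hhbar : 0 < hbar) {a : Phase n → ℂ}
    (ha : Integrable a) {A : L2 n →L[ℂ] L2 n} (hA : IsWeylOperator hbar a A) :
    ∫ z, ⟪coherent hhbar z, A (coherent hhbar z)⟫_ℂ =
      coherentConst n hbar * ((1 / (2 * Real.pi * hbar) : ℂ) ^ n * ∫ w, a w) := by
  simp_rw [inner_coherent_apply_coherent hhbar ha hA]
  have : (volume : Measure (Phase n)).IsAddRightInvariant :=
    inferInstanceAs ((volume : Measure (Config n)).prod volume).IsAddRightInvariant
  have hW : Integrable fun v : Phase n => (coherentWigner hbar v : ℂ) :=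
    (integrable_coherentWigner hhbar).ofReal
  have h := integral_convolution (ContinuousLinearMap.mul ℝ ℂ) ha hW (𝕜 := ℝ)
  simp only [convolution_def, ContinuousLinearMap.mul_apply'] at h
  rw [integral_const_mul, h, integral_complex_ofReal, integral_coherentWigner hhbar]
  ring

theorem hasSum_inner_of_isWeylOperator (hhbar : 0 < hbar) {a : Phase n → ℂ}
    (ha : Integrable a) {A : L2 n →L[ℂ] L2 n} (hA : IsWeylOperator hbar a A)
    (htr : IsTraceClass A) {ι : Type*} (ψ : HilbertBasis ι ℂ (L2 n)) :
    HasSum (fun j => ⟪ψ j, A (ψ j)⟫_ℂ) ((1 / (2 * Real.pi * hbar) : ℂ) ^ n * ∫ w, a w) := by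
  have hpi := Real.pi_pos
  have hC : 0 < coherentConst n hbar := by
    unfold coherentConst
    positivity
  have := ψ.countable_of_separableSpace
  obtain ⟨h1, -, h3⟩ := hasFrameTrace_of_forall_summable
    (fun f => (stronglyMeasurable_inner_coherent hhbar f).measurable.aemeasurable)
    ENNReal.ofReal_ne_top (lintegral_enorm_inner_coherent_sq hhbar) ψ A
    -- Trace class enters through pairs of equal bases only.
    (fun w e => htr w e e)
  rw [integral_inner_coherent_apply_coherent hhbar ha hA, ENNReal.toReal_ofReal hC.le] at h3
  rw [mul_left_cancel₀ (by exact_mod_cast hC.ne') h3]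
  exact h1.hasSum

theorem symplecticFourier_zero (a : Phase n → ℂ) :
    symplecticFourier hbar a 0 = (1 / (2 * Real.pi * hbar) : ℂ) ^ n * ∫ z, a z := by
  simp [symplecticFourier, symplecticForm]

end WeylTrace

theorem mainTheorem7 (n : ℕ) (hbar : ℝ) (hhbar : 0 < hbar)
    (a : WeylTrace.Phase n → ℂ) (A : WeylTrace.L2 n →L[ℂ] WeylTrace.L2 n)
    (hA : WeylTrace.IsWeylOperator hbar a A)
    (htr : WeylTrace.IsTraceClass A)
    (ha : Integrable a) :
    (∀ (ι : Type) (ψ : HilbertBasis ι ℂ (WeylTrace.L2 n)),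
      HasSum (fun j => inner ℂ (ψ j) (A (ψ j))) (WeylTrace.trace A)) ∧
    WeylTrace.trace A = (1 / (2 * Real.pi * hbar) : ℂ) ^ n * ∫ z : WeylTrace.Phase n, a z ∧
    WeylTrace.trace A = WeylTrace.symplecticFourier hbar a 0 := by
  have htrace : WeylTrace.trace A =
      (1 / (2 * Real.pi * hbar) : ℂ) ^ n * ∫ z : WeylTrace.Phase n, a z :=
    (WeylTrace.hasSum_inner_of_isWeylOperator hhbar ha hA htr _).tsum_eq
  refine ⟨fun ι ψ => ?_, htrace, by rw [htrace, WeylTrace.symplecticFourier_zero]⟩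
  rw [htrace]
  exact WeylTrace.hasSum_inner_of_isWeylOperator hhbar ha hA htr ψ
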